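/- For complex numbers $a,q$ with $|q|<1$ write $(a;q)_n=\prod_{j=0}^{n-1}(1-aq^j)$ (so $(a;q)_0=1$), $(a;q)_\infty=\prod_{j=0}^{\infty}(1-aq^j)$ and $(a_1,a_2;q)_\infty=(a_1;q)_\infty(a_2;q)_\infty$. Then for every complex number $q$ with $|q|<1$ the following two series converge absolutely and $$\sum_{n=0}^{\infty}\frac{(1+q^{-2n+3})\,q^{n^2+6n}}{(q^4;q^4)_n}=\frac{1}{(q^2,q^3;q^5)_\infty\,(-q^2;q^2)_\infty},$$ $$\sum_{n=0}^{\infty}\frac{(1+q^{-2n+1})\,q^{n^2+4n}}{(q^4;q^4)_n}=\frac{1}{(q,q^4;q^5)_\infty\,(-q^2;q^2)_\infty}.$$ (For $q=0$ the numerators are read as the polynomials $q^{n^2+6n}+q^{n^2+4n+3}$ and $q^{n^2+4n}+q^{n^2+2n+1}$, respectively.) -/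

import Mathlib

/-- The finite `q`-shifted factorial `(a; q)_n = ∏_{j=0}^{n-1} (1 - a q^j)`. -/
def qPoch (a q : ℂ) (n : ℕ) : ℂ :=
  ∏ j ∈ Finset.range n, (1 - a * q ^ j)

/-- The infinite `q`-shifted factorial `(a; q)_∞ = ∏_{j=0}^∞ (1 - a q^j)`, for `|q| < 1`. -/
noncomputable def qPochInf (a q : ℂ) : ℂ :=
  ∏' j : ℕ, (1 - a * q ^ j)

/-- For `|q| < 1` the infinite product defining `(a; q)_∞` converges. -/
theorem qPochInf_multipliable (a : ℂ) {q : ℂ} (hq : ‖q‖ < 1) :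
    Multipliable (fun j : ℕ => 1 - a * q ^ j) := by
  have h : Summable (fun j : ℕ => ‖-(a * q ^ j)‖) := by
    simp only [norm_neg, norm_mul, norm_pow]
    exact (summable_geometric_of_lt_one (norm_nonneg q) hq).mul_left _
  simpa [sub_eq_add_neg] using multipliable_one_add_of_summable h

open Filter Topology

/-! Both identities are Rogers–Ramanujan identities in disguise, with d = 1 for the first and d = 0
for the second. Put g_n = q^(n(n+2d)) / (q⁴;q⁴)_n. A telescoping rearrangement (`hasSum_slater`)
shows that each series equals ∑ g_n. Expanding (-q^(2+2n);q²)_∞ by Euler and summing along n + k = N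
turns (-q²;q²)_∞ ∑ g_n into ∑ q^(N(N+d)) / (q;q)_N (`tsum_pow_div_qPoch`); the inner sums are
Rogers–Szegő polynomials with a closed form. The last series is evaluated by `rogers_ramanujan`: two
Bailey steps from the unit pair, the limit n → ∞, and the Jacobi triple product in base q⁵.
Splitting (q;q)_∞ modulo 5 then leaves the stated products. -/

theorem one_sub_pow_succ_ne_zero {q : ℂ} (hq : ‖q‖ < 1) (n : ℕ) : 1 - q ^ (n + 1) ≠ 0 := by
  intro h
  have h1 : ‖q ^ (n + 1)‖ < 1 := by
    rw [norm_pow]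
    exact pow_lt_one₀ (norm_nonneg q) hq (Nat.succ_ne_zero n)
  rw [← sub_eq_zero.mp h, norm_one] at h1
  exact lt_irrefl _ h1

theorem qPoch_succ (a q : ℂ) (n : ℕ) : qPoch a q (n + 1) = qPoch a q n * (1 - a * q ^ n) :=
  Finset.prod_range_succ _ _

theorem qPoch_self_ne_zero {q : ℂ} (hq : ‖q‖ < 1) (n : ℕ) : qPoch q q n ≠ 0 := by
  refine Finset.prod_ne_zero_iff.mpr fun j _ => ?_
  rw [← pow_succ']
  exact one_sub_pow_succ_ne_zero hq j

theorem tendsto_qPoch (a : ℂ) {q : ℂ} (hq : ‖q‖ < 1) :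
    Tendsto (qPoch a q) atTop (𝓝 (qPochInf a q)) :=
  (qPochInf_multipliable a hq).hasProd.tendsto_prod_nat

theorem qPochInf_ne_zero {a q : ℂ} (hq : ‖q‖ < 1) (h : ∀ j : ℕ, 1 - a * q ^ j ≠ 0) :
    qPochInf a q ≠ 0 := by
  have hs : Summable (fun j : ℕ => ‖-(a * q ^ j)‖) := by
    simp only [norm_neg, norm_mul, norm_pow]
    exact (summable_geometric_of_lt_one (norm_nonneg q) hq).mul_left _
  have := tprod_one_add_ne_zero_of_summable (f := fun j : ℕ => -(a * q ^ j))
    (fun j => by simpa [sub_eq_add_neg] using h j) hs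
  simpa [qPochInf, sub_eq_add_neg] using this

theorem qPochInf_ne_zero_of_norm_lt_one {a q : ℂ} (hq : ‖q‖ < 1) (ha : ‖a‖ < 1) :
    qPochInf a q ≠ 0 := by
  refine qPochInf_ne_zero hq fun j h => ?_
  have h1 : ‖a * q ^ j‖ < 1 := by
    rw [norm_mul, norm_pow]
    calc ‖a‖ * ‖q‖ ^ j ≤ ‖a‖ * 1 := by
          gcongr
          exact pow_le_one₀ (norm_nonneg q) hq.le
      _ < 1 := by simpa using ha
  rw [← sub_eq_zero.mp h, norm_one] at h1
  exact lt_irrefl _ h1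

/-! ### Reciprocals of (q;q)_n over the integers -/

/-- The reciprocal `1 / (q; q)_n`, extended by zero to negative integers `n`. -/
noncomputable def qPochInv (q : ℂ) (n : ℤ) : ℂ :=
  if 0 ≤ n then (qPoch q q n.toNat)⁻¹ else 0

theorem qPochInv_of_neg (q : ℂ) {n : ℤ} (hn : n < 0) : qPochInv q n = 0 := by
  simp [qPochInv, hn]

theorem qPochInv_natCast (q : ℂ) (n : ℕ) : qPochInv q n = (qPoch q q n)⁻¹ := by
  simp [qPochInv]

theorem qPochInv_zero (q : ℂ) : qPochInv q 0 = 1 := by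
  simp [qPochInv, qPoch]

/-- Extension by zero is consistent because the factor vanishes at n = 0. Recurrences for bilateral
sums therefore need no boundary terms. -/
theorem one_sub_zpow_mul_qPochInv {q : ℂ} (hq : ‖q‖ < 1) (n : ℤ) :
    (1 - q ^ n) * qPochInv q n = qPochInv q (n - 1) := by
  rcases lt_trichotomy n 0 with hn | rfl | hn
  · rw [qPochInv_of_neg q hn, qPochInv_of_neg q (by lia), mul_zero]
  · rw [qPochInv_of_neg q (n := 0 - 1) (by norm_num)]
    simp
  · obtain ⟨m, rfl⟩ : ∃ m : ℕ, n = (m + 1 : ℕ) := ⟨(n - 1).toNat, by lia⟩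
    have h2 : ((m + 1 : ℕ) : ℤ) - 1 = (m : ℕ) := by lia
    rw [h2, qPochInv_natCast, qPochInv_natCast, qPoch_succ, zpow_natCast, ← pow_succ', mul_inv]
    have := one_sub_pow_succ_ne_zero hq m
    field_simp

theorem one_sub_zpow_ne_zero {q : ℂ} (hq : ‖q‖ < 1) {n : ℤ} (hn : 0 < n) : 1 - q ^ n ≠ 0 := by
  obtain ⟨m, rfl⟩ : ∃ m : ℕ, n = (m + 1 : ℕ) := ⟨(n - 1).toNat, by lia⟩
  rw [zpow_natCast]
  exact one_sub_pow_succ_ne_zero hq m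

theorem tendsto_qPochInv {q : ℂ} (hq : ‖q‖ < 1) :
    Tendsto (qPochInv q) atTop (𝓝 (qPochInf q q)⁻¹) := by
  have h : Tendsto (fun n : ℤ => (qPoch q q n.toNat)⁻¹) atTop (𝓝 (qPochInf q q)⁻¹) :=
    ((tendsto_qPoch q hq).inv₀ (qPochInf_ne_zero_of_norm_lt_one hq hq)).comp
      (tendsto_atTop_atTop.mpr fun b => ⟨b, fun a ha => by lia⟩)
  refine h.congr' ?_
  filter_upwards [eventually_ge_atTop 0] with n hn
  simp [qPochInv, hn]

theorem exists_norm_qPochInv_le {q : ℂ} (hq : ‖q‖ < 1) :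
    ∃ C : ℝ, 0 ≤ C ∧ ∀ n : ℤ, ‖qPochInv q n‖ ≤ C := by
  have h : Tendsto (fun n : ℕ => (qPoch q q n)⁻¹) atTop (𝓝 (qPochInf q q)⁻¹) :=
    (tendsto_qPoch q hq).inv₀ (qPochInf_ne_zero_of_norm_lt_one hq hq)
  obtain ⟨C, hC⟩ := (Metric.isBounded_range_of_tendsto _ h).exists_norm_le
  have h0 : 0 ≤ C := (norm_nonneg _).trans (hC _ ⟨0, rfl⟩)
  refine ⟨C, h0, fun n => ?_⟩
  unfold qPochInv
  split_ifs
  · exact hC _ ⟨_, rfl⟩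
  · simpa using h0

/-! ### The triple product, finite and infinite, and Euler's expansion -/

/-- The triangular exponent `k (k - 1) / 2`. -/
def tri (k : ℤ) : ℤ := k * (k - 1) / 2

theorem two_mul_tri (k : ℤ) : 2 * tri k = k * (k - 1) :=
  Int.mul_ediv_cancel' (Int.even_mul_pred_self k).two_dvd

theorem tri_add_one (k : ℤ) : tri (k + 1) = tri k + k := by
  have h1 := two_mul_tri k
  have h2 := two_mul_tri (k + 1)
  linarith

theorem summable_of_eq_zero_outside {f : ℤ → ℂ} (a b : ℤ) (h : ∀ k, k < a ∨ b < k → f k = 0) :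
    Summable f :=
  summable_of_ne_finset_zero (s := Finset.Icc a b) fun k hk => h k <| by
    simp only [Finset.mem_Icc] at hk
    lia

theorem summable_mul_qPochInv_mul (q : ℂ) (t : ℤ → ℂ) (M N : ℤ) :
    Summable fun k => t k * qPochInv q (M - k) * qPochInv q (N + k) :=
  summable_of_eq_zero_outside (-N) M fun k hk => by
    rcases hk with hk | hk
    · rw [qPochInv_of_neg q (n := N + k) (by lia), mul_zero]
    · rw [qPochInv_of_neg q (n := M - k) (by lia), mul_zero, zero_mul]

theorem tsum_int_add_one (f : ℤ → ℂ) : ∑' k, f (k + 1) = ∑' k, f k :=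
  (Equiv.addRight (1 : ℤ)).tsum_eq f

theorem tsum_int_sub_left (f : ℤ → ℂ) (N : ℤ) : ∑' k, f (N - k) = ∑' k, f k :=
  (Equiv.subLeft N).tsum_eq f

/-- With A = M+1-k and B = N+k, split 1 - q^(A+B) = (1 - q^A) + q^A (1 - q^B). Each bracket lowers
one index, and the shift k → k+1 makes the second sum a multiple of the first. -/
theorem finite_triple_step_left {q x : ℂ} (hq : ‖q‖ < 1) (hq0 : q ≠ 0) (hx : x ≠ 0) (M N : ℤ) :
    (1 - q ^ (M + 1 + N)) *
        ∑' k : ℤ, x ^ k * q ^ tri k * qPochInv q (M + 1 - k) * qPochInv q (N + k) =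
      (1 + x * q ^ M) * ∑' k : ℤ, x ^ k * q ^ tri k * qPochInv q (M - k) * qPochInv q (N + k) := by
  have h2 : ∑' k : ℤ, x ^ k * q ^ tri k * q ^ (M + 1 - k) * qPochInv q (M + 1 - k) *
      qPochInv q (N - 1 + k) =
      (x * q ^ M) * ∑' k : ℤ, x ^ k * q ^ tri k * qPochInv q (M - k) * qPochInv q (N + k) := by
    rw [← tsum_int_add_one, ← tsum_mul_left]
    refine tsum_congr fun k => ?_
    rw [tri_add_one, show M + 1 - (k + 1) = M - k by ring, show N - 1 + (k + 1) = N + k by ring,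
      zpow_add₀ hq0, zpow_sub₀ hq0, zpow_add_one₀ hx]
    have := zpow_ne_zero k hq0
    field_simp
  rw [add_mul, one_mul, ← h2, ← Summable.tsum_add (summable_mul_qPochInv_mul q _ M N)
    (summable_mul_qPochInv_mul q _ (M + 1) (N - 1)), ← tsum_mul_left]
  refine tsum_congr fun k => ?_
  have e1 := one_sub_zpow_mul_qPochInv hq (M + 1 - k)
  have e2 := one_sub_zpow_mul_qPochInv hq (N + k)
  rw [show M + 1 - k - 1 = M - k by ring] at e1
  rw [show N + k - 1 = N - 1 + k by ring] at e2
  have e3 : q ^ (M + 1 + N) = q ^ (M + 1 - k) * q ^ (N + k) := by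
    rw [← zpow_add₀ hq0]; congr 1; ring
  rw [← e1, ← e2, e3]
  ring

theorem tri_neg (k : ℤ) : tri (-k) = tri k + k := by
  have h1 := two_mul_tri k
  have h2 := two_mul_tri (-k)
  linarith

/-- The reflection k → -k; it lets one induction on M serve for N as well. -/
theorem finite_triple_symm (q x : ℂ) (hq0 : q ≠ 0) (M N : ℤ) :
    ∑' k : ℤ, x ^ k * q ^ tri k * qPochInv q (M - k) * qPochInv q (N + k) =
      ∑' k : ℤ, (q / x) ^ k * q ^ tri k * qPochInv q (N - k) * qPochInv q (M + k) := by
  rw [← (Equiv.neg ℤ).tsum_eq]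
  refine tsum_congr fun k => ?_
  simp only [Equiv.neg_apply]
  rw [tri_neg, zpow_add₀ hq0, div_zpow, zpow_neg, sub_neg_eq_add, ← sub_eq_add_neg]
  ring

theorem finite_triple_zero_zero (q x : ℂ) :
    ∑' k : ℤ, x ^ k * q ^ tri k * qPochInv q (0 - k) * qPochInv q (0 + k) = 1 := by
  rw [tsum_eq_single 0]
  · simp [qPochInv_zero, tri]
  · intro k hk
    rcases lt_or_gt_of_ne hk with h | h
    · rw [qPochInv_of_neg q (n := 0 + k) (by lia), mul_zero]
    · rw [qPochInv_of_neg q (n := 0 - k) (by lia), mul_zero, zero_mul]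

theorem finite_triple_aux {q x : ℂ} (hq : ‖q‖ < 1) (hq0 : q ≠ 0) (hx : x ≠ 0) (N : ℤ) (hN : 0 ≤ N)
    (c : ℂ) (h0 : ∑' k : ℤ, x ^ k * q ^ tri k * qPochInv q (0 - k) * qPochInv q (N + k) =
      qPochInv q N * c) (M : ℕ) :
    ∑' k : ℤ, x ^ k * q ^ tri k * qPochInv q (M - k) * qPochInv q (N + k) =
      qPochInv q (M + N) * (qPoch (-x) q M * c) := by
  induction M with
  | zero => simpa [qPoch] using h0
  | succ M ih =>
    have hne : 1 - q ^ ((M : ℤ) + 1 + N) ≠ 0 := one_sub_zpow_ne_zero hq (by lia)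
    have h := finite_triple_step_left hq hq0 hx M N
    have e := one_sub_zpow_mul_qPochInv hq ((M : ℤ) + 1 + N)
    rw [show (M : ℤ) + 1 + N - 1 = M + N by ring] at e
    rw [ih, ← e] at h
    push_cast
    refine mul_left_cancel₀ hne (h.trans ?_)
    rw [qPoch_succ, zpow_natCast]
    ring

/-- A finite form of the Jacobi triple product identity. -/
theorem finite_triple {q x : ℂ} (hq : ‖q‖ < 1) (hq0 : q ≠ 0) (hx : x ≠ 0) (M N : ℕ) :
    ∑' k : ℤ, (-x) ^ k * q ^ tri k * qPochInv q (M - k) * qPochInv q (N + k) =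
      qPochInv q (M + N) * (qPoch x q M * qPoch (q / x) q N) := by
  have hx' : -x ≠ 0 := neg_ne_zero.mpr hx
  have h1 := finite_triple_aux hq hq0 (x := q / -x) (div_ne_zero hq0 hx') 0 le_rfl 1
    (by rw [finite_triple_zero_zero, qPochInv_zero, mul_one]) N
  rw [← finite_triple_symm q (-x) hq0 0 N] at h1
  have h2 := finite_triple_aux hq hq0 hx' N (Int.natCast_nonneg N) (qPoch (q / x) q N)
    (by rw [h1]; simp [div_neg]) M
  simpa using h2

theorem summable_norm_zpow_mul_zpow_tri_nat {q x : ℂ} (hq : ‖q‖ < 1) (hq0 : q ≠ 0) (hx : x ≠ 0) :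
    Summable fun n : ℕ => ‖x ^ (n : ℤ) * q ^ tri n‖ := by
  refine summable_of_ratio_test_tendsto_lt_one (l := 0) one_pos ?_ ?_
  · exact Eventually.of_forall fun n => norm_ne_zero_iff.mpr
      (mul_ne_zero (zpow_ne_zero _ hx) (zpow_ne_zero _ hq0))
  · have h : Tendsto (fun n : ℕ => ‖x‖ * ‖q‖ ^ n) atTop (𝓝 0) := by
      simpa using (tendsto_pow_atTop_nhds_zero_of_lt_one (norm_nonneg q) hq).const_mul ‖x‖
    refine h.congr fun n => ?_
    rw [norm_norm, norm_norm, ← norm_div, Nat.cast_succ, tri_add_one, zpow_add₀ hq0,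
      zpow_add_one₀ hx, ← norm_pow, ← norm_mul, zpow_natCast, zpow_natCast]
    congr 1
    have := pow_ne_zero n hx
    have := zpow_ne_zero (tri n) hq0
    field_simp

theorem summable_norm_zpow_mul_zpow_tri {q x : ℂ} (hq : ‖q‖ < 1) (hq0 : q ≠ 0) (hx : x ≠ 0) :
    Summable fun k : ℤ => ‖x ^ k * q ^ tri k‖ := by
  refine Summable.of_nat_of_neg (summable_norm_zpow_mul_zpow_tri_nat hq hq0 hx) ?_
  refine (summable_norm_zpow_mul_zpow_tri_nat hq hq0 (div_ne_zero hq0 hx)).congr fun n => ?_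
  rw [tri_neg, zpow_add₀ hq0, div_zpow, zpow_neg]
  congr 1
  ring

/-- Dominated convergence in the form that takes the finite identities to their limits. -/
theorem tendsto_tsum_mul_of_bounded {ι : Type*} {t : ι → ℂ} (ht : Summable fun k => ‖t k‖)
    {u : ℕ → ι → ℂ} {C : ℝ} (hC : ∀ n k, ‖u n k‖ ≤ C) {l : ℂ}
    (hu : ∀ k, Tendsto (fun n => u n k) atTop (𝓝 l)) :
    Tendsto (fun n => ∑' k, t k * u n k) atTop (𝓝 ((∑' k, t k) * l)) := by
  rw [← tsum_mul_right]
  refine tendsto_tsum_of_dominated_convergence (ht.mul_right C) (fun k => (hu k).const_mul _) ?_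
  refine Eventually.of_forall fun n k => ?_
  rw [norm_mul]
  exact mul_le_mul_of_nonneg_left (hC n k) (norm_nonneg _)

theorem tendsto_qPochInv_add {q : ℂ} (hq : ‖q‖ < 1) (a : ℤ) :
    Tendsto (fun n : ℕ => qPochInv q (n + a)) atTop (𝓝 (qPochInf q q)⁻¹) :=
  (tendsto_qPochInv hq).comp
    (tendsto_atTop_add_const_right _ a tendsto_natCast_atTop_atTop)

theorem tendsto_tsum_mul_qPochInv {ι : Type*} {q : ℂ} (hq : ‖q‖ < 1) {t : ι → ℂ}
    (ht : Summable fun k => ‖t k‖) (v : ι → ℤ) :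
    Tendsto (fun n : ℕ => ∑' k, t k * qPochInv q (n - v k)) atTop
      (𝓝 ((∑' k, t k) * (qPochInf q q)⁻¹)) := by
  obtain ⟨C, -, hC⟩ := exists_norm_qPochInv_le hq
  exact tendsto_tsum_mul_of_bounded ht (fun _ _ => hC _) fun k =>
    tendsto_qPochInv_add hq (-v k)

theorem tendsto_tsum_mul_qPochInv_mul_qPochInv {q : ℂ} (hq : ‖q‖ < 1) {t : ℤ → ℂ}
    (ht : Summable fun k => ‖t k‖) (d : ℤ) :
    Tendsto (fun n : ℕ => ∑' k, t k * qPochInv q (n - k) * qPochInv q (n + d + k)) atTop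
      (𝓝 ((∑' k, t k) * ((qPochInf q q)⁻¹ * (qPochInf q q)⁻¹))) := by
  obtain ⟨C, hC0, hC⟩ := exists_norm_qPochInv_le hq
  simp only [mul_assoc]
  refine tendsto_tsum_mul_of_bounded (C := C * C) ht (fun n k => ?_) fun k => ?_
  · rw [norm_mul]
    exact mul_le_mul (hC _) (hC _) (norm_nonneg _) hC0
  · refine (tendsto_qPochInv_add hq (-k)).mul ?_
    simpa only [add_assoc] using tendsto_qPochInv_add hq (d + k)

/-- The Jacobi triple product identity. -/
theorem jacobi_triple {q x : ℂ} (hq : ‖q‖ < 1) (hq0 : q ≠ 0) (hx : x ≠ 0) :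
    ∑' k : ℤ, (-x) ^ k * q ^ tri k = qPochInf x q * qPochInf (q / x) q * qPochInf q q := by
  have hE := qPochInf_ne_zero_of_norm_lt_one hq hq
  have h1 := tendsto_tsum_mul_qPochInv_mul_qPochInv hq
    (summable_norm_zpow_mul_zpow_tri hq hq0 (neg_ne_zero.mpr hx)) 0
  have h2 : Tendsto (fun n : ℕ => qPochInv q (n + n) * (qPoch x q n * qPoch (q / x) q n)) atTop
      (𝓝 ((qPochInf q q)⁻¹ * (qPochInf x q * qPochInf (q / x) q))) := by
    refine Tendsto.mul ?_ ((tendsto_qPoch x hq).mul (tendsto_qPoch (q / x) hq))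
    exact (tendsto_qPochInv hq).comp
      (tendsto_natCast_atTop_atTop.atTop_add_atTop tendsto_natCast_atTop_atTop)
  have h3 := tendsto_nhds_unique h1 (h2.congr fun n => by
    rw [add_zero]; exact (finite_triple hq hq0 hx n n).symm)
  field_simp at h3
  rw [h3]
  ring

/-- Euler's expansion of `(x; q)_∞`. -/
theorem tsum_euler {q x : ℂ} (hq : ‖q‖ < 1) (hq0 : q ≠ 0) (hx : x ≠ 0) :
    ∑' k : ℤ, (-x) ^ k * q ^ tri k * qPochInv q k = qPochInf x q := by
  have hE := qPochInf_ne_zero_of_norm_lt_one hq hq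
  obtain ⟨C, -, hC⟩ := exists_norm_qPochInv_le hq
  have hs : Summable fun k : ℤ => ‖(-x) ^ k * q ^ tri k * qPochInv q k‖ := by
    refine Summable.of_nonneg_of_le (fun _ => norm_nonneg _) (fun k => ?_)
      ((summable_norm_zpow_mul_zpow_tri hq hq0 (neg_ne_zero.mpr hx)).mul_right C)
    rw [norm_mul]
    exact mul_le_mul_of_nonneg_left (hC k) (norm_nonneg _)
  have h1 := tendsto_tsum_mul_qPochInv hq hs id
  have h2 : Tendsto (fun n : ℕ => qPochInv q n * qPoch x q n) atTop
      (𝓝 ((qPochInf q q)⁻¹ * qPochInf x q)) := by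
    simpa using (tendsto_qPochInv_add hq 0).mul (tendsto_qPoch x hq)
  have h3 := tendsto_nhds_unique h1 (h2.congr fun n => by
    have := finite_triple hq hq0 hx n 0
    simp only [Nat.cast_zero, add_zero, zero_add, qPoch, Finset.range_zero, Finset.prod_empty,
      mul_one] at this
    rw [qPoch, ← this]
    exact tsum_congr fun k => mul_right_comm _ _ _)
  field_simp at h3
  exact h3

/-! ### q-Vandermonde and the Bailey chain -/

theorem summable_vandermonde (q : ℂ) (t : ℤ → ℂ) (m n c : ℤ) :
    Summable fun s => t s * qPochInv q (m - s) * qPochInv q (s + n) * qPochInv q (s + c) :=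
  summable_of_eq_zero_outside (-n) m fun k hk => by
    rcases hk with hk | hk
    · rw [qPochInv_of_neg q (n := k + n) (by lia), mul_zero, zero_mul]
    · rw [qPochInv_of_neg q (n := m - k) (by lia), mul_zero, zero_mul, zero_mul]

/-- A limiting case of the `q`-Vandermonde summation. -/
theorem tsum_vandermonde {q : ℂ} (hq : ‖q‖ < 1) (hq0 : q ≠ 0) (m : ℕ) (c : ℤ) :
    ∑' s : ℤ, q ^ (s * (s + c)) * qPochInv q (m - s) * qPochInv q s * qPochInv q (s + c) =
      qPochInv q m * qPochInv q (m + c) := by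
  induction m generalizing c with
  | zero =>
    rw [tsum_eq_single 0]
    · simp [qPochInv_zero]
    · intro k hk
      rcases lt_or_gt_of_ne hk with h | h
      · rw [qPochInv_of_neg q (n := k) (by lia), mul_zero, zero_mul]
      · rw [qPochInv_of_neg q (n := (0 : ℕ) - k) (by lia), mul_zero, zero_mul, zero_mul]
  | succ m ih =>
    have hne : 1 - q ^ ((m : ℤ) + 1) ≠ 0 := one_sub_zpow_ne_zero hq (by lia)
    -- Second half of the splitting 1 - q^(m+1) = (1 - q^(m+1-s)) + q^(m+1-s) (1 - q^s). After s →
    -- s+1 it is the induction hypothesis at c + 1, hence the generalization over c.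
    have h2 : ∑' s : ℤ, q ^ (s * (s + c)) * q ^ (m + 1 - s) * qPochInv q (m + 1 - s) *
        qPochInv q (s - 1) * qPochInv q (s + c) =
        q ^ (m + 1 + c) * (qPochInv q m * qPochInv q (m + (c + 1))) := by
      rw [← tsum_int_add_one, ← ih (c + 1), ← tsum_mul_left]
      refine tsum_congr fun s => ?_
      rw [show (m : ℤ) + 1 - (s + 1) = m - s by ring, show s + 1 - 1 = s by ring,
        show s + 1 + c = s + (c + 1) by ring, ← zpow_add₀ hq0]
      have : q ^ ((s + 1) * (s + (c + 1)) + (m - s)) =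
          q ^ ((m : ℤ) + 1 + c) * q ^ (s * (s + (c + 1))) := by
        rw [← zpow_add₀ hq0]; congr 1; ring
      rw [this]
      ring
    have h1 := ih c
    have e := one_sub_zpow_mul_qPochInv hq ((m : ℤ) + 1)
    have e' := one_sub_zpow_mul_qPochInv hq ((m : ℤ) + 1 + c)
    rw [show (m : ℤ) + 1 - 1 = m by ring] at e
    rw [show (m : ℤ) + 1 + c - 1 = m + c by ring] at e'
    push_cast
    refine mul_left_cancel₀ hne ?_
    rw [← mul_assoc, e]
    calc _ = (∑' s : ℤ, q ^ (s * (s + c)) * qPochInv q (m - s) * qPochInv q s *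
            qPochInv q (s + c)) +
          ∑' s : ℤ, q ^ (s * (s + c)) * q ^ (m + 1 - s) * qPochInv q (m + 1 - s) *
            qPochInv q (s - 1) * qPochInv q (s + c) := by
          have s1 := summable_vandermonde q (fun s => q ^ (s * (s + c))) m 0 c
          simp only [add_zero] at s1
          have s2 := summable_vandermonde q
            (fun s => q ^ (s * (s + c)) * q ^ (m + 1 - s)) (m + 1) (-1) c
          simp only [← sub_eq_add_neg] at s2
          rw [← Summable.tsum_add s1 s2, ← tsum_mul_left]
          refine tsum_congr fun s => ?_
          have e1 := one_sub_zpow_mul_qPochInv hq ((m : ℤ) + 1 - s)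
          have e2 := one_sub_zpow_mul_qPochInv hq s
          rw [show (m : ℤ) + 1 - s - 1 = m - s by ring] at e1
          have e3 : q ^ ((m : ℤ) + 1) = q ^ ((m : ℤ) + 1 - s) * q ^ s := by
            rw [← zpow_add₀ hq0]; congr 1; ring
          rw [← e1, ← e2, e3]
          ring
      _ = _ := by
          rw [h1, h2, ← e', show (m : ℤ) + (c + 1) = m + 1 + c by ring]
          ring

theorem tsum_vandermonde_int {q : ℂ} (hq : ‖q‖ < 1) (hq0 : q ≠ 0) (m c : ℤ) :
    ∑' s : ℤ, q ^ (s * (s + c)) * qPochInv q (m - s) * qPochInv q s * qPochInv q (s + c) =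
      qPochInv q m * qPochInv q (m + c) := by
  rcases lt_or_ge m 0 with hm | hm
  · rw [qPochInv_of_neg q hm, zero_mul, ← tsum_zero (β := ℤ)]
    refine tsum_congr fun s => ?_
    rcases lt_or_ge s 0 with h | h
    · rw [qPochInv_of_neg q h, mul_zero, zero_mul]
    · rw [qPochInv_of_neg q (n := m - s) (by lia), mul_zero, zero_mul, zero_mul]
  · lift m to ℕ using hm
    exact tsum_vandermonde hq hq0 m c

theorem tsum_int_eq_sum_range {f : ℤ → ℂ} (n : ℕ) (h : ∀ r : ℤ, r < 0 ∨ n < r → f r = 0) :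
    ∑' r, f r = ∑ r ∈ Finset.range (n + 1), f r := by
  have hs : Function.support f ⊆ Set.range ((↑) : ℕ → ℤ) := by
    intro r hr
    have h0 : 0 ≤ r := by
      by_contra h0
      exact hr (h r (Or.inl (not_le.mp h0)))
    exact ⟨r.toNat, Int.toNat_of_nonneg h0⟩
  rw [← Nat.cast_injective.tsum_eq hs]
  refine tsum_eq_sum fun r hr => h r (Or.inr ?_)
  simp only [Finset.mem_range] at hr
  lia

/-- The substitution r = s + k reduces this to q-Vandermonde with m = n - k and c = 2k + d. -/
theorem sum_bailey_kernel {q : ℂ} (hq : ‖q‖ < 1) (hq0 : q ≠ 0) {d : ℕ} (hd : d ≤ 1) (n : ℕ)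
    (k : ℤ) :
    ∑ r ∈ Finset.range (n + 1), q ^ ((r : ℤ) * (r + d)) * qPochInv q (n - r) *
        (qPochInv q (r - k) * qPochInv q (r + d + k)) =
      q ^ (k * (k + d)) * qPochInv q (n - k) * qPochInv q (n + d + k) := by
  rw [← tsum_int_eq_sum_range (f := fun r : ℤ => q ^ (r * (r + d)) * qPochInv q (n - r) *
        (qPochInv q (r - k) * qPochInv q (r + d + k))) n]
  · rw [← (Equiv.addRight k).tsum_eq]
    have h := tsum_vandermonde_int hq hq0 (n - k) (2 * k + d)
    rw [show (n : ℤ) - k + (2 * k + d) = n + d + k by ring] at h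
    rw [mul_assoc, ← h, ← tsum_mul_left]
    refine tsum_congr fun s => ?_
    simp only [Equiv.coe_addRight]
    rw [show (s + k) * (s + k + d) = k * (k + d) + s * (s + (2 * k + d)) by ring,
      zpow_add₀ hq0, show (n : ℤ) - (s + k) = n - k - s by ring, add_sub_cancel_right,
      show s + k + d + k = s + (2 * k + d) by ring]
    ring
  · intro r hr
    rcases hr with hr | hr
    -- If k ≤ r ≤ -1 then r + d + k ≤ d - 2 < 0; this is where d ≤ 1 enters.
    · rcases lt_or_ge r k with h | h
      · rw [qPochInv_of_neg q (n := r - k) (by lia), zero_mul, mul_zero]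
      · rw [qPochInv_of_neg q (n := r + d + k) (by lia), mul_zero, mul_zero]
    · rw [qPochInv_of_neg q (n := n - r) (by lia), mul_zero, zero_mul]

/-- One step of the Bailey chain. -/
theorem bailey_step {q : ℂ} (hq : ‖q‖ < 1) (hq0 : q ≠ 0) {d : ℕ} (hd : d ≤ 1) (α : ℤ → ℂ)
    (n : ℕ) :
    ∑ r ∈ Finset.range (n + 1), q ^ ((r : ℤ) * (r + d)) * qPochInv q (n - r) *
        ∑' k : ℤ, α k * qPochInv q (r - k) * qPochInv q (r + d + k) =
      ∑' k : ℤ, α k * q ^ (k * (k + d)) * qPochInv q (n - k) * qPochInv q (n + d + k) := by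
  simp only [← tsum_mul_left]
  have hs : ∀ r ∈ Finset.range (n + 1), Summable fun k : ℤ =>
      q ^ ((r : ℤ) * (r + d)) * qPochInv q (n - r) *
        (α k * qPochInv q (r - k) * qPochInv q (r + d + k)) := fun r _ =>
    (summable_mul_qPochInv_mul q α r (r + d)).mul_left _
  rw [← Summable.tsum_finsetSum hs]
  refine tsum_congr fun k => ?_
  rw [show α k * q ^ (k * (k + d)) * qPochInv q (n - k) * qPochInv q (n + d + k) =
    α k * (q ^ (k * (k + d)) * qPochInv q (n - k) * qPochInv q (n + d + k)) by ring,
    ← sum_bailey_kernel hq hq0 hd n k, Finset.mul_sum]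
  exact Finset.sum_congr rfl fun r _ => by ring

/-- The finite triple product at x = 1, where (1;q)_r has a zero factor once r > 0. -/
theorem unit_bailey_pair {q : ℂ} (hq : ‖q‖ < 1) (hq0 : q ≠ 0) (d r : ℕ) :
    ∑' k : ℤ, (-1) ^ k * q ^ tri k * qPochInv q (r - k) * qPochInv q (r + d + k) =
      if r = 0 then 1 else 0 := by
  have h := finite_triple hq hq0 one_ne_zero r (r + d)
  push_cast at h
  rw [h, div_one]
  split_ifs with hr
  · subst hr
    have h1 : qPoch 1 q 0 = 1 := Finset.prod_range_zero _
    rw [h1, Nat.cast_zero, zero_add, zero_add, zero_add, qPochInv_natCast, one_mul,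
      inv_mul_cancel₀ (qPoch_self_ne_zero hq d)]
  · have h1 : qPoch 1 q r = 0 :=
      Finset.prod_eq_zero (Finset.mem_range.mpr (Nat.pos_of_ne_zero hr)) (by simp)
    rw [h1, zero_mul, mul_zero]

theorem tsum_bailey_once {q : ℂ} (hq : ‖q‖ < 1) (hq0 : q ≠ 0) {d : ℕ} (hd : d ≤ 1) (n : ℕ) :
    ∑' k : ℤ, (-1) ^ k * q ^ tri k * q ^ (k * (k + d)) * qPochInv q (n - k) *
      qPochInv q (n + d + k) = qPochInv q n := by
  rw [← bailey_step hq hq0 hd, Finset.sum_eq_single 0]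
  · rw [unit_bailey_pair hq hq0]
    simp
  · intro r _ hr
    rw [unit_bailey_pair hq hq0, if_neg hr, mul_zero]
  · simp

/-! ### The Rogers–Ramanujan identities -/

theorem summable_norm_zpow_mul_add_mul_qPochInv {q p : ℂ} (hq : ‖q‖ < 1) (hq0 : q ≠ 0)
    (hp : ‖p‖ < 1) (d : ℤ) : Summable fun r : ℤ => ‖q ^ (r * (r + d)) * qPochInv p r‖ := by
  obtain ⟨C, -, hC⟩ := exists_norm_qPochInv_le hp
  have hq2 : ‖q ^ 2‖ < 1 := by
    rw [norm_pow]
    exact pow_lt_one₀ (norm_nonneg q) hq two_ne_zero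
  refine Summable.of_nonneg_of_le (fun _ => norm_nonneg _) (fun r => ?_)
    ((summable_norm_zpow_mul_zpow_tri hq2 (pow_ne_zero 2 hq0)
      (zpow_ne_zero (1 + d) hq0)).mul_right C)
  rw [norm_mul, ← zpow_natCast, ← zpow_mul, ← zpow_mul, ← zpow_add₀ hq0]
  have h : (1 + d) * r + ((2 : ℕ) : ℤ) * tri r = r * (r + d) := by
    have := two_mul_tri r
    push_cast
    linarith
  rw [h]
  exact mul_le_mul_of_nonneg_left (hC r) (norm_nonneg _)

/-- The Rogers–Ramanujan identities, with the product given by the Jacobi triple product. -/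
theorem rogers_ramanujan {q : ℂ} (hq : ‖q‖ < 1) (hq0 : q ≠ 0) {d : ℕ} (hd : d ≤ 1) :
    ∑' r : ℤ, q ^ (r * (r + d)) * qPochInv q r =
      (qPochInf q q)⁻¹ * (qPochInf (q ^ (2 + 2 * d)) (q ^ 5) *
        qPochInf (q ^ 5 / q ^ (2 + 2 * d)) (q ^ 5) * qPochInf (q ^ 5) (q ^ 5)) := by
  have hE := qPochInf_ne_zero_of_norm_lt_one hq hq
  have hq5 : ‖q ^ 5‖ < 1 := by
    rw [norm_pow]
    exact pow_lt_one₀ (norm_nonneg q) hq (by norm_num)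
  have hq50 : q ^ 5 ≠ 0 := pow_ne_zero 5 hq0
  have hx : q ^ (2 + 2 * d) ≠ 0 := pow_ne_zero _ hq0
  rw [← jacobi_triple hq5 hq50 hx]
  have h1 := tendsto_tsum_mul_qPochInv hq
    (summable_norm_zpow_mul_add_mul_qPochInv hq hq0 hq d) id
  have h2 := tendsto_tsum_mul_qPochInv_mul_qPochInv hq
    (summable_norm_zpow_mul_zpow_tri hq5 hq50 (neg_ne_zero.mpr hx)) d
  have h3 := tendsto_nhds_unique h1 (h2.congr fun n => by
    -- Second Bailey step. The exponent becomes tri k + 2k(k+d) = (2+2d)k + 5 tri k, which is the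
    -- source of the base q⁵ and of x = q^(2+2d).
    have h := bailey_step hq hq0 hd (fun k => (-1) ^ k * q ^ tri k * q ^ (k * (k + d))) n
    simp only [tsum_bailey_once hq hq0 hd] at h
    calc _ = ∑' k : ℤ, (-1) ^ k * q ^ tri k * q ^ (k * (k + d)) * q ^ (k * (k + d)) *
          qPochInv q (n - k) * qPochInv q (n + d + k) := by
          refine tsum_congr fun k => ?_
          have e : q ^ tri k * q ^ (k * (k + d)) * q ^ (k * (k + d)) =
              (q ^ (2 + 2 * d)) ^ k * (q ^ 5) ^ tri k := by
            rw [← zpow_natCast, ← zpow_natCast, ← zpow_mul, ← zpow_mul, ← zpow_add₀ hq0,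
              ← zpow_add₀ hq0, ← zpow_add₀ hq0]
            congr 1
            have := two_mul_tri k
            push_cast
            linarith
          rw [neg_eq_neg_one_mul, mul_zpow, mul_assoc ((-1) ^ k) _ ((q ^ 5) ^ tri k), ← e]
          ring
      _ = ∑ r ∈ Finset.range (n + 1), q ^ ((r : ℤ) * (r + d)) * qPochInv q (n - r) *
          qPochInv q r := h.symm
      _ = _ := by
          rw [tsum_int_eq_sum_range n]
          · exact Finset.sum_congr rfl fun r _ => mul_right_comm _ _ _
          · intro r hr
            rcases hr with hr | hr
            · rw [qPochInv_of_neg q hr, mul_zero, zero_mul]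
            · rw [qPochInv_of_neg q (n := n - id r) (sub_neg.mpr hr), mul_zero])
  field_simp at h3 ⊢
  exact h3

theorem qPoch_self_five_mul (q : ℂ) (n : ℕ) :
    qPoch q q (5 * n) = qPoch q (q ^ 5) n * qPoch (q ^ 2) (q ^ 5) n * qPoch (q ^ 3) (q ^ 5) n *
      qPoch (q ^ 4) (q ^ 5) n * qPoch (q ^ 5) (q ^ 5) n := by
  induction n with
  | zero => simp [qPoch]
  | succ n ih =>
    rw [show 5 * (n + 1) = 5 * n + 1 + 1 + 1 + 1 + 1 by ring]
    simp only [qPoch_succ, ih]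
    ring

theorem qPochInf_self_eq_mul_five {q : ℂ} (hq : ‖q‖ < 1) :
    qPochInf q q = qPochInf q (q ^ 5) * qPochInf (q ^ 2) (q ^ 5) * qPochInf (q ^ 3) (q ^ 5) *
      qPochInf (q ^ 4) (q ^ 5) * qPochInf (q ^ 5) (q ^ 5) := by
  have hq5 : ‖q ^ 5‖ < 1 := by
    rw [norm_pow]
    exact pow_lt_one₀ (norm_nonneg q) hq (by norm_num)
  have h1 : Tendsto (fun n : ℕ => qPoch q q (5 * n)) atTop (𝓝 (qPochInf q q)) :=
    (tendsto_qPoch q hq).comp (tendsto_id.const_mul_atTop' (by norm_num))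
  have t := fun a : ℂ => tendsto_qPoch a hq5
  exact tendsto_nhds_unique h1
    (((((t q).mul (t (q ^ 2))).mul (t (q ^ 3))).mul (t (q ^ 4))).mul (t (q ^ 5)) |>.congr
      fun n => (qPoch_self_five_mul q n).symm)

/-! ### A Rogers–Szegő sum and the double series -/

/-- Let S_N carry the weight q^k and T_N the weight q^(-k). Reflection k → N-k gives S_N = q^N T_N,
while q^(-k)(1 - q^(2k)) = q^(-k) - q^k gives T_N - S_N = q⁻¹ T_(N-1). Eliminating T yields the
recurrence. -/
theorem rogers_szego_step {q : ℂ} (hq : ‖q‖ < 1) (hq0 : q ≠ 0) (N : ℤ) :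
    (1 - q ^ N) * ∑' k : ℤ, q ^ k * qPochInv (q ^ 2) (N - k) * qPochInv (q ^ 2) k =
      ∑' k : ℤ, q ^ k * qPochInv (q ^ 2) (N - 1 - k) * qPochInv (q ^ 2) k := by
  have hp : ‖q ^ 2‖ < 1 := by
    rw [norm_pow]
    exact pow_lt_one₀ (norm_nonneg q) hq two_ne_zero
  have symm : ∀ M : ℤ, q ^ M * ∑' k : ℤ, q ^ (-k) * qPochInv (q ^ 2) (M - k) *
      qPochInv (q ^ 2) k = ∑' k : ℤ, q ^ k * qPochInv (q ^ 2) (M - k) * qPochInv (q ^ 2) k := by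
    intro M
    rw [← tsum_int_sub_left (fun k => q ^ k * qPochInv (q ^ 2) (M - k) * qPochInv (q ^ 2) k) M,
      ← tsum_mul_left]
    refine tsum_congr fun k => ?_
    rw [sub_sub_cancel, sub_eq_add_neg, zpow_add₀ hq0]
    ring
  have shift : ∑' k : ℤ, q ^ (-k) * qPochInv (q ^ 2) (N - k) * qPochInv (q ^ 2) (k - 1) =
      q⁻¹ * ∑' k : ℤ, q ^ (-k) * qPochInv (q ^ 2) (N - 1 - k) * qPochInv (q ^ 2) k := by
    rw [← tsum_int_add_one, ← tsum_mul_left]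
    refine tsum_congr fun k => ?_
    rw [add_sub_cancel_right, show N - (k + 1) = N - 1 - k by ring, neg_add, zpow_add₀ hq0,
      zpow_neg_one]
    ring
  have hs : ∀ t : ℤ → ℂ, Summable fun k => t k * qPochInv (q ^ 2) (N - k) *
      qPochInv (q ^ 2) k := fun t => by
    simpa using summable_mul_qPochInv_mul (q ^ 2) t N 0
  have diff : ∑' k : ℤ, q ^ (-k) * qPochInv (q ^ 2) (N - k) * qPochInv (q ^ 2) (k - 1) =
      (∑' k : ℤ, q ^ (-k) * qPochInv (q ^ 2) (N - k) * qPochInv (q ^ 2) k) -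
        ∑' k : ℤ, q ^ k * qPochInv (q ^ 2) (N - k) * qPochInv (q ^ 2) k := by
    rw [← Summable.tsum_sub (hs _) (hs _)]
    refine tsum_congr fun k => ?_
    have e : (q ^ 2) ^ k = q ^ k * q ^ k := by rw [pow_two, mul_zpow]
    rw [← one_sub_zpow_mul_qPochInv hp k, e, zpow_neg]
    have := zpow_ne_zero k hq0
    field_simp
  have s1 := symm N
  have s2 := symm (N - 1)
  rw [zpow_sub_one₀ hq0] at s2
  have e := diff.symm.trans shift
  rw [← s2, mul_assoc, ← e, mul_sub, s1]
  ring

theorem tsum_rogers_szego_nat {q : ℂ} (hq : ‖q‖ < 1) (hq0 : q ≠ 0) (N : ℕ) :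
    ∑' k : ℤ, q ^ k * qPochInv (q ^ 2) (N - k) * qPochInv (q ^ 2) k = qPochInv q N := by
  induction N with
  | zero =>
    rw [tsum_eq_single 0]
    · simp [qPochInv_zero]
    · intro k hk
      rcases lt_or_gt_of_ne hk with h | h
      · rw [qPochInv_of_neg _ h, mul_zero]
      · rw [qPochInv_of_neg _ (n := (0 : ℕ) - k) (by lia), mul_zero, zero_mul]
  | succ N ih =>
    have hne : 1 - q ^ ((N : ℤ) + 1) ≠ 0 := one_sub_zpow_ne_zero hq (by lia)
    have h := rogers_szego_step hq hq0 ((N : ℤ) + 1)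
    have e := one_sub_zpow_mul_qPochInv hq ((N : ℤ) + 1)
    rw [add_sub_cancel_right] at h e
    push_cast
    exact mul_left_cancel₀ hne (h.trans (ih.trans e.symm))

theorem tsum_rogers_szego {q : ℂ} (hq : ‖q‖ < 1) (hq0 : q ≠ 0) (N : ℤ) :
    ∑' k : ℤ, q ^ k * qPochInv (q ^ 2) (N - k) * qPochInv (q ^ 2) k = qPochInv q N := by
  rcases lt_or_ge N 0 with hN | hN
  · rw [qPochInv_of_neg q hN, ← tsum_zero (β := ℤ)]
    refine tsum_congr fun k => ?_
    rcases lt_or_ge k 0 with h | h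
    · rw [qPochInv_of_neg _ h, mul_zero]
    · rw [qPochInv_of_neg _ (n := N - k) (by lia), mul_zero, zero_mul]
  · lift N to ℕ using hN
    exact tsum_rogers_szego_nat hq hq0 N

/-- The weight is what remains of the exponent in `tsum_double` after n = N - k and removal of
N(N+d). For d = 1 it is the d = 0 sum reflected. -/
theorem tsum_rogers_szego_twist {q : ℂ} (hq : ‖q‖ < 1) (hq0 : q ≠ 0) {d : ℕ} (hd : d ≤ 1)
    (N : ℤ) :
    ∑' k : ℤ, q ^ (d * N + (1 - 2 * d) * k) * qPochInv (q ^ 2) (N - k) * qPochInv (q ^ 2) k =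
      qPochInv q N := by
  rw [← tsum_rogers_szego hq hq0 N]
  interval_cases d
  · simp
  · rw [← tsum_int_sub_left (fun k => q ^ k * qPochInv (q ^ 2) (N - k) * qPochInv (q ^ 2) k) N]
    refine tsum_congr fun k => ?_
    rw [sub_sub_cancel, show ((1 : ℕ) : ℤ) * N + (1 - 2 * ((1 : ℕ) : ℤ)) * k = N - k by
      push_cast; ring]
    ring

theorem qPochInf_eq_qPoch_mul (a : ℂ) {q : ℂ} (hq : ‖q‖ < 1) (n : ℕ) :
    qPochInf a q = qPoch a q n * qPochInf (a * q ^ n) q := by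
  have h1 : Tendsto (fun m : ℕ => qPoch a q (n + m)) atTop (𝓝 (qPochInf a q)) :=
    (tendsto_qPoch a hq).comp (tendsto_atTop_mono (fun m => Nat.le_add_left m n) tendsto_id)
  refine tendsto_nhds_unique h1 (((tendsto_qPoch (a * q ^ n) hq).const_mul _).congr fun m => ?_)
  simp only [qPoch, Finset.prod_range_add, pow_add, mul_assoc]

theorem qPoch_sq_sq (p : ℂ) (n : ℕ) :
    qPoch (p ^ 2) (p ^ 2) n = qPoch p p n * qPoch (-p) p n := by
  rw [qPoch, qPoch, qPoch, ← Finset.prod_mul_distrib]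
  exact Finset.prod_congr rfl fun j _ => by ring

theorem summable_norm_pow_natAbs {q : ℂ} (hq : ‖q‖ < 1) :
    Summable fun k : ℤ => ‖q‖ ^ k.natAbs := by
  have := summable_geometric_of_lt_one (norm_nonneg q) hq
  exact Summable.of_nat_of_neg (by simpa using this) (by simpa using this)

theorem summable_double {q : ℂ} (hq : ‖q‖ < 1) (d : ℕ) :
    Summable fun z : ℤ × ℤ => q ^ (z.1 * (z.1 + 2 * d) + 2 * z.1 * z.2 + z.2 * (z.2 + 1)) *
      qPochInv (q ^ 2) z.1 * qPochInv (q ^ 2) z.2 := by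
  have hp : ‖q ^ 2‖ < 1 := by
    rw [norm_pow]
    exact pow_lt_one₀ (norm_nonneg q) hq two_ne_zero
  obtain ⟨C, hC0, hC⟩ := exists_norm_qPochInv_le hp
  have hg := summable_norm_pow_natAbs hq
  refine Summable.of_norm_bounded (((hg.mul_of_nonneg hg (fun _ => by positivity)
    fun _ => by positivity)).mul_right (C * C)) fun ⟨n, k⟩ => ?_
  rcases lt_or_ge n 0 with hn | hn
  · rw [qPochInv_of_neg _ hn]
    simp only [mul_zero, zero_mul, norm_zero]
    positivity
  rcases lt_or_ge k 0 with hk | hk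
  · rw [qPochInv_of_neg _ hk]
    simp only [mul_zero, norm_zero]
    positivity
  lift n to ℕ using hn
  lift k to ℕ using hk
  rw [mul_assoc, norm_mul, norm_mul]
  refine mul_le_mul ?_ (mul_le_mul (hC _) (hC _) (norm_nonneg _) hC0) (by positivity)
    (by positivity)
  simp only [Int.natAbs_natCast]
  rw [← pow_add, show (n : ℤ) * (n + 2 * d) + 2 * n * k + k * (k + 1) =
    ((n * (n + 2 * d) + 2 * n * k + k * (k + 1) : ℕ) : ℤ) by push_cast; rfl, zpow_natCast,
    norm_pow]
  refine pow_le_pow_of_le_one (norm_nonneg q) hq.le ?_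
  have := Nat.le_self_pow two_ne_zero n
  -- The exponent is at least n + k, so a product of two geometric series dominates.
  nlinarith [Nat.zero_le (n * d), Nat.zero_le (n * k), Nat.zero_le (k * k)]

theorem tsum_double {q : ℂ} (hq : ‖q‖ < 1) (hq0 : q ≠ 0) {d : ℕ} (hd : d ≤ 1) :
    ∑' n : ℤ, ∑' k : ℤ, q ^ (n * (n + 2 * d) + 2 * n * k + k * (k + 1)) *
      qPochInv (q ^ 2) n * qPochInv (q ^ 2) k = ∑' N : ℤ, q ^ (N * (N + d)) * qPochInv q N := by
  let f : ℤ × ℤ → ℂ := fun z => q ^ (z.1 * (z.1 + 2 * d) + 2 * z.1 * z.2 + z.2 * (z.2 + 1)) *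
      qPochInv (q ^ 2) z.1 * qPochInv (q ^ 2) z.2
  have hf : Summable f := summable_double hq d
  let e : ℤ × ℤ ≃ ℤ × ℤ :=
    ⟨fun z => (z.1 - z.2, z.2), fun z => (z.1 + z.2, z.2), fun z => by simp, fun z => by simp⟩
  have h1 : ∑' n : ℤ, ∑' k : ℤ, f (n, k) = ∑' N : ℤ, ∑' k : ℤ, f (e (N, k)) := by
    rw [← hf.tsum_prod, ← e.tsum_eq]
    exact Summable.tsum_prod (f := f ∘ e) (e.summable_iff.mpr hf)
  refine h1.trans (tsum_congr fun N => ?_)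
  rw [← tsum_rogers_szego_twist hq hq0 hd N, ← tsum_mul_left]
  refine tsum_congr fun k => ?_
  simp only [f, e, Equiv.coe_fn_mk]
  rw [← mul_assoc, ← mul_assoc, ← zpow_add₀ hq0]
  congr 3
  ring

theorem tsum_euler_shifted {q : ℂ} (hq : ‖q‖ < 1) (hq0 : q ≠ 0) (n : ℕ) :
    ∑' k : ℤ, q ^ (2 * n * k + k * (k + 1)) * qPochInv (q ^ 2) k =
      qPochInf (-q ^ 2 * (q ^ 2) ^ n) (q ^ 2) := by
  have hp : ‖q ^ 2‖ < 1 := by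
    rw [norm_pow]
    exact pow_lt_one₀ (norm_nonneg q) hq two_ne_zero
  rw [← tsum_euler hp (pow_ne_zero 2 hq0)
    (mul_ne_zero (neg_ne_zero.mpr (pow_ne_zero 2 hq0)) (pow_ne_zero n (pow_ne_zero 2 hq0)))]
  refine tsum_congr fun k => ?_
  congr 1
  rw [neg_mul, neg_neg, ← pow_succ', ← pow_mul, ← zpow_natCast, ← zpow_natCast, ← zpow_mul,
    ← zpow_mul, ← zpow_add₀ hq0]
  congr 1
  have := two_mul_tri k
  push_cast
  linarith

theorem summable_norm_pow_div_qPoch {q : ℂ} (hq : ‖q‖ < 1) (hq0 : q ≠ 0) (d : ℕ) :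
    Summable fun n : ℕ => ‖q ^ (n * (n + 2 * d)) / qPoch (q ^ 4) (q ^ 4) n‖ := by
  have hq4 : ‖q ^ 4‖ < 1 := by
    rw [norm_pow]
    exact pow_lt_one₀ (norm_nonneg q) hq (by norm_num)
  refine ((summable_norm_zpow_mul_add_mul_qPochInv hq hq0 hq4 (2 * d)).comp_injective
    Nat.cast_injective).congr fun n => ?_
  rw [Function.comp_apply, qPochInv_natCast, div_eq_mul_inv, ← zpow_natCast]
  push_cast
  rfl

/-- Rogers' reduction of a series over `(q⁴; q⁴)_n` to the Rogers–Ramanujan series. -/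
theorem tsum_pow_div_qPoch {q : ℂ} (hq : ‖q‖ < 1) (hq0 : q ≠ 0) {d : ℕ} (hd : d ≤ 1) :
    qPochInf (-q ^ 2) (q ^ 2) * ∑' n : ℕ, q ^ (n * (n + 2 * d)) / qPoch (q ^ 4) (q ^ 4) n =
      ∑' N : ℤ, q ^ (N * (N + d)) * qPochInv q N := by
  have hp : ‖q ^ 2‖ < 1 := by
    rw [norm_pow]
    exact pow_lt_one₀ (norm_nonneg q) hq two_ne_zero
  have hq4 : ‖q ^ 4‖ < 1 := by
    rw [norm_pow]
    exact pow_lt_one₀ (norm_nonneg q) hq (by norm_num)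
  rw [← tsum_double hq hq0 hd, ← tsum_mul_left, ← Nat.cast_injective.tsum_eq (f := fun n : ℤ =>
    ∑' k : ℤ, q ^ (n * (n + 2 * d) + 2 * n * k + k * (k + 1)) * qPochInv (q ^ 2) n *
      qPochInv (q ^ 2) k)]
  · refine tsum_congr fun n => ?_
    have h1 : ∑' k : ℤ, q ^ ((n : ℤ) * (n + 2 * d) + 2 * n * k + k * (k + 1)) *
        qPochInv (q ^ 2) n * qPochInv (q ^ 2) k = q ^ (n * (n + 2 * d)) * qPochInv (q ^ 2) n *
          qPochInf (-q ^ 2 * (q ^ 2) ^ n) (q ^ 2) := by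
      rw [← tsum_euler_shifted hq hq0, ← tsum_mul_left]
      refine tsum_congr fun k => ?_
      rw [add_assoc, zpow_add₀ hq0, ← zpow_natCast q (n * (n + 2 * d))]
      push_cast
      ring
    rw [h1, qPochInf_eq_qPoch_mul (-q ^ 2) hp n, qPochInv_natCast]
    have h2 := qPoch_sq_sq (q ^ 2) n
    rw [← pow_mul] at h2
    have h3 : qPoch (q ^ 4) (q ^ 4) n ≠ 0 := qPoch_self_ne_zero hq4 n
    rw [h2] at h3
    have h4 := left_ne_zero_of_mul h3
    have h5 := right_ne_zero_of_mul h3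
    rw [h2]
    field_simp
  · intro n hn
    have h0 : 0 ≤ n := by
      by_contra h0
      refine hn ?_
      simp only [qPochInv_of_neg _ (not_le.mp h0), mul_zero, zero_mul, tsum_zero]
    exact ⟨n.toNat, Int.toNat_of_nonneg h0⟩

/-! ### Telescoping and the final identities -/

theorem HasSum.add_sub_succ {g h : ℕ → ℂ} {s : ℂ} (hg : HasSum g s) (hh : Summable h)
    (h0 : g 0 = h 0) : HasSum (fun n => h n + (g (n + 1) - h (n + 1))) s := by
  have h1 := (hasSum_nat_add_iff' 1).mpr (hg.sub hh.hasSum)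
  rw [Finset.sum_range_one, h0, sub_self, sub_zero] at h1
  simpa using hh.hasSum.add h1

/-- With h_n = q^(4n) g_n, the factor 1 - q^(4(n+1)) cancels in g_(n+1) - h_(n+1), so the n-th term
is h_n + (g_(n+1) - h_(n+1)). As g_0 = h_0, the total is ∑ g_n. -/
theorem hasSum_slater {q : ℂ} (hq : ‖q‖ < 1) (hq0 : q ≠ 0) {d : ℕ} (hd : d ≤ 1) :
    HasSum (fun n : ℕ => (1 + q ^ (-2 * (n : ℤ) + (1 + 2 * d : ℕ))) *
        q ^ (n ^ 2 + (4 + 2 * d) * n) / qPoch (q ^ 4) (q ^ 4) n)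
      ((qPochInf q q)⁻¹ * (qPochInf (q ^ (2 + 2 * d)) (q ^ 5) *
        qPochInf (q ^ 5 / q ^ (2 + 2 * d)) (q ^ 5) * qPochInf (q ^ 5) (q ^ 5)) /
          qPochInf (-q ^ 2) (q ^ 2)) := by
  have hp : ‖q ^ 2‖ < 1 := by
    rw [norm_pow]
    exact pow_lt_one₀ (norm_nonneg q) hq two_ne_zero
  have hq4 : ‖q ^ 4‖ < 1 := by
    rw [norm_pow]
    exact pow_lt_one₀ (norm_nonneg q) hq (by norm_num)
  have hN : qPochInf (-q ^ 2) (q ^ 2) ≠ 0 :=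
    qPochInf_ne_zero_of_norm_lt_one hp (by rwa [norm_neg])
  have hs := summable_norm_pow_div_qPoch hq hq0 d
  rw [← rogers_ramanujan hq hq0 hd, ← tsum_pow_div_qPoch hq hq0 hd, mul_div_cancel_left₀ _ hN]
  have hh : Summable fun n : ℕ =>
      q ^ (n * (n + 2 * d)) / qPoch (q ^ 4) (q ^ 4) n * (q ^ 4) ^ n := by
    refine Summable.of_norm_bounded hs fun n => ?_
    rw [norm_mul, norm_pow]
    exact mul_le_of_le_one_right (norm_nonneg _) (pow_le_one₀ (norm_nonneg _) hq4.le)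
  convert hs.of_norm.hasSum.add_sub_succ hh (by simp) using 1
  funext n
  have e1 : q ^ (-2 * (n : ℤ) + (1 + 2 * d : ℕ)) * q ^ (n ^ 2 + (4 + 2 * d) * n) =
      q ^ ((n + 1) * (n + 1 + 2 * d)) := by
    rw [← zpow_natCast, ← zpow_natCast, ← zpow_add₀ hq0]
    congr 1
    push_cast
    ring
  have e2 : q ^ (n * (n + 2 * d)) * (q ^ 4) ^ n = q ^ (n ^ 2 + (4 + 2 * d) * n) := by
    rw [← pow_mul, ← pow_add]
    congr 1
    ring
  have h1 : 1 - q ^ 4 * (q ^ 4) ^ n ≠ 0 := by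
    rw [← pow_succ']
    exact one_sub_pow_succ_ne_zero hq4 n
  rw [add_mul, one_mul, e1, ← e2, qPoch_succ, pow_succ' (q ^ 4) n]
  have h3 : ∀ c : ℂ, c / (qPoch (q ^ 4) (q ^ 4) n * (1 - q ^ 4 * (q ^ 4) ^ n)) -
      c / (qPoch (q ^ 4) (q ^ 4) n * (1 - q ^ 4 * (q ^ 4) ^ n)) * (q ^ 4 * (q ^ 4) ^ n) =
        c / qPoch (q ^ 4) (q ^ 4) n := fun c => by
    rw [← mul_one_sub, ← div_div, div_mul_cancel₀ _ h1]
  rw [h3]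
  ring

theorem qPochInf_zero_zero : qPochInf 0 0 = 1 := by
  simp [qPochInf]

/-- At q = 0 only n = 0 survives: for n > 0 the factor 0^(n²+bn) kills the term whatever value the
integer power takes, in agreement with the polynomial reading. -/
theorem hasSum_slater_zero (a b : ℕ) (hb : b ≠ 0) :
    HasSum (fun n : ℕ => (1 + (0 : ℂ) ^ (-2 * (n : ℤ) + (2 * a + 1 : ℕ))) *
      0 ^ (n ^ 2 + b * n) / qPoch (0 ^ 4) (0 ^ 4) n) 1 := by
  have h : ∀ n : ℕ, n ≠ 0 → (1 + (0 : ℂ) ^ (-2 * (n : ℤ) + (2 * a + 1 : ℕ))) *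
      0 ^ (n ^ 2 + b * n) / qPoch (0 ^ 4) (0 ^ 4) n = 0 := fun n hn => by
    rw [zero_pow (by positivity), mul_zero, zero_div]
  convert hasSum_single 0 h using 1
  have e : (0 : ℂ) ^ (-2 * ((0 : ℕ) : ℤ) + (2 * a + 1 : ℕ)) = 0 :=
    zero_zpow _ (by push_cast; lia)
  rw [e]
  simp [qPoch]

theorem mainTheorem8 (q : ℂ) (hq : ‖q‖ < 1) :
    HasSum
        (fun n : ℕ =>
          (1 + q ^ (-2 * (n : ℤ) + 3)) * q ^ (n ^ 2 + 6 * n) / qPoch (q ^ 4) (q ^ 4) n)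
        (1 / (qPochInf (q ^ 2) (q ^ 5) * qPochInf (q ^ 3) (q ^ 5) *
          qPochInf (-q ^ 2) (q ^ 2))) ∧
      HasSum
        (fun n : ℕ =>
          (1 + q ^ (-2 * (n : ℤ) + 1)) * q ^ (n ^ 2 + 4 * n) / qPoch (q ^ 4) (q ^ 4) n)
        (1 / (qPochInf q (q ^ 5) * qPochInf (q ^ 4) (q ^ 5) *
          qPochInf (-q ^ 2) (q ^ 2))) := by
  rcases eq_or_ne q 0 with rfl | hq0
  · have h1 := hasSum_slater_zero 1 6 (by norm_num)
    have h2 := hasSum_slater_zero 0 4 (by norm_num)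
    have h0 := qPochInf_zero_zero
    norm_num at h1 h2
    norm_num [h0]
    exact ⟨h1, h2⟩
  · have hE := qPochInf_ne_zero_of_norm_lt_one hq hq
    have h5 := qPochInf_self_eq_mul_five hq
    rw [h5] at hE
    simp only [mul_ne_zero_iff] at hE
    obtain ⟨⟨⟨⟨n1, n2⟩, n3⟩, n4⟩, n5⟩ := hE
    -- d = 0 cancels the residues 2, 3, 5 from (q;q)_∞ and leaves 1, 4; d = 1 cancels 1, 4, 5 and
    -- leaves 2, 3.
    have h0 := hasSum_slater hq hq0 (d := 0) (by norm_num)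
    have h1 := hasSum_slater hq hq0 (d := 1) (by norm_num)
    norm_num only [Nat.cast_ofNat, Nat.cast_one] at h0 h1
    have d0 : q ^ 5 / q ^ 2 = q ^ 3 := by field_simp
    have d1 : q ^ 5 / q ^ 4 = q := by field_simp
    rw [h5, d0] at h0
    rw [h5, d1] at h1
    refine ⟨?_, ?_⟩
    · convert h1 using 1
      field_simp
    · convert h0 using 1
      field_simp
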